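/- For lattice points $u\in\mathbb{Z}^2$ and real $\rho\ge 0$ let $B_\rho(u)=\{v\in\mathbb{Z}^2 : d(u,v)\le \rho\}$, where $d$ is the Euclidean distance, and put $$S_{r,\Delta}(u,v)=\bigl(B_r(u)\setminus B_{r+\Delta}(v)\bigr)\cup\bigl(B_r(v)\setminus B_{r+\Delta}(u)\bigr).$$ A set $C\subseteq\mathbb{Z}^2$ is an $(r,\Delta)$-identifying code if $B_r(u)\cap C\neq\emptyset$ for every $u\in\mathbb{Z}^2$ and $S_{r,\Delta}(u,v)\cap C\neq\emptyset$ for all distinct $u,v\in\mathbb{Z}^2$. The density of $C\subseteq \mathbb{Z}^2$ is $D(C)=\limsup_{n\to\infty}|C\cap Q_n|/|Q_n|$ with $Q_n=\{(x,y)\in\mathbb{Z}^2: |x|\le n,\ |y|\le n\}$, and an $(r,\Delta)$-identifying code is optimal if no $(r,\Delta)$-identifying code has lower density. Let $k\geq 18$ be an integer such that $k\equiv 2 \bmod 16$, and let $L=\left(\frac{k}{2}\right)^2-1$, $r=\sqrt{L^2+8}$ and $r+\Delta=\sqrt{L^2+2L+4}$. Then $|S_{r,\Delta}((0,0),(-1,0))|=8$,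 and $S_{r,\Delta}((0,0),(-1,0))$ intersects all the diagonal lines modulo $8$: for each $i\in\{0,1,\dots,7\}$ it contains a point $(x,y)$ with $y-x\equiv i \bmod 8$ (so its eight points lie on different diagonal lines modulo $8$). Moreover, there is a constant $r_0$, independent of $k$, such that whenever $r\ge r_0$ there is an optimal $(r,\Delta)$-identifying code of density $\frac18$. -/

import Mathlib

namespace TolerantCode

/-- A vertex of the lattice `ℤ²`, seen as a point of the Euclidean plane. -/
noncomputable def toPlane (u : ℤ × ℤ) : EuclideanSpace ℝ (Fin 2) := !₂[(u.1 : ℝ), (u.2 : ℝ)]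

/-- The ball `B_r(u)`: the lattice vertices at Euclidean distance at most `r` from `u`. -/
def ball (r : ℝ) (u : ℤ × ℤ) : Set (ℤ × ℤ) := {v | dist (toPlane u) (toPlane v) ≤ r}

/-- The set `S_{r,Δ}(u,v) = (B_r(u) \ B_{r+Δ}(v)) ∪ (B_r(v) \ B_{r+Δ}(u))`. -/
def sepSet (r Δ : ℝ) (u v : ℤ × ℤ) : Set (ℤ × ℤ) :=
  (ball r u \ ball (r + Δ) v) ∪ (ball r v \ ball (r + Δ) u)

/-- `C` is an `(r, Δ)`-tolerant identifying code. -/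
def IsIdentifyingCode (r Δ : ℝ) (C : Set (ℤ × ℤ)) : Prop :=
  (∀ u, (ball r u ∩ C).Nonempty) ∧ ∀ u v, u ≠ v → (sepSet r Δ u v ∩ C).Nonempty

/-- The square `Q_n = {(x, y) | |x| ≤ n, |y| ≤ n}`. -/
def square (n : ℕ) : Set (ℤ × ℤ) := {p | |p.1| ≤ (n : ℤ) ∧ |p.2| ≤ (n : ℤ)}

/-- The density `D(C) = limsup |C ∩ Q_n| / |Q_n|`. All sets counted here are finite, and the
quotients lie in `[0, 1]`. -/
noncomputable def density (C : Set (ℤ × ℤ)) : ℝ :=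
  Filter.limsup (fun n : ℕ => ((C ∩ square n).ncard : ℝ) / ((square n).ncard : ℝ)) Filter.atTop

/-- An `(r, Δ)`-identifying code is optimal if no `(r, Δ)`-identifying code has lower density. -/
def IsOptimalCode (r Δ : ℝ) (C : Set (ℤ × ℤ)) : Prop :=
  IsIdentifyingCode r Δ C ∧ ∀ C', IsIdentifyingCode r Δ C' → density C ≤ density C'

/-- `U` is intersecting all the diagonal lines modulo `m`. -/
def IntersectsDiagonalsMod (m : ℕ) (U : Set (ℤ × ℤ)) : Prop :=
  ∀ i < m, ∃ p ∈ U, p.2 - p.1 ≡ (i : ℤ) [ZMOD (m : ℤ)]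

end TolerantCode

namespace TolerantCode
open Filter Topology

/-! Put m = k/2, so m ≡ 1 mod 8, and l = L = m² - 1. Only eight points separate two horizontal
neighbours (`sepSet_unit`). Every translate of this set meets any code, so double counting forces
density at least 1/8 (`inv_card_le_density`). Conversely, these eight points realise every residue
of y - x mod 8, so the code y ≡ x mod 8, of density 1/8, separates all neighbours, by translation
and reflection in y = x. For any other pair, the crescent B_r(u) \ B_{r+Δ}(v) alone meets every
diagonal once l is large (`oneSided_of_two_le`). -/

lemma dist_toPlane (u v : ℤ × ℤ) :
    dist (toPlane u) (toPlane v) = √(((u.1 - v.1) ^ 2 + (u.2 - v.2) ^ 2 : ℤ) : ℝ) := by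
  simp [toPlane, EuclideanSpace.dist_eq, Fin.sum_univ_two, Real.dist_eq, sq_abs]

lemma mem_ball_sqrt {A : ℤ} (hA : 0 ≤ A) (u v : ℤ × ℤ) :
    v ∈ ball √(A : ℝ) u ↔ (u.1 - v.1) ^ 2 + (u.2 - v.2) ^ 2 ≤ A := by
  rw [ball, Set.mem_ofPred_eq, dist_toPlane, Real.sqrt_le_sqrt_iff (by exact_mod_cast hA)]
  exact_mod_cast Iff.rfl

lemma mem_sepSet_sqrt {A B : ℤ} (hA : 0 ≤ A) (hB : 0 ≤ B) {r Δ : ℝ} (hr : r = √(A : ℝ))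
    (hrΔ : r + Δ = √(B : ℝ)) (u v p : ℤ × ℤ) :
    p ∈ sepSet r Δ u v ↔
      ((u.1 - p.1) ^ 2 + (u.2 - p.2) ^ 2 ≤ A ∧ B < (v.1 - p.1) ^ 2 + (v.2 - p.2) ^ 2) ∨
      ((v.1 - p.1) ^ 2 + (v.2 - p.2) ^ 2 ≤ A ∧ B < (u.1 - p.1) ^ 2 + (u.2 - p.2) ^ 2) := by
  rw [sepSet, hrΔ, hr]
  simp only [Set.mem_union, Set.mem_sdiff, mem_ball_sqrt hA, mem_ball_sqrt hB, not_le]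

/-! ### Separating two horizontal neighbours -/

/-- The eight points that separate `(0, 0)` from `(-1, 0)`. -/
def unitSep (m : ℤ) : Finset (ℤ × ℤ) :=
  {(m ^ 2 - 1, 2), (m ^ 2 - 1, -2), (m ^ 2 - 3, 2 * m), (m ^ 2 - 3, -(2 * m)),
    (-m ^ 2, 2), (-m ^ 2, -2), (2 - m ^ 2, 2 * m), (2 - m ^ 2, -(2 * m))}

lemma card_unitSep {m : ℤ} (hm : 9 ≤ m) : (unitSep m).card = 8 := by
  have : 81 ≤ m ^ 2 := by nlinarith
  unfold unitSep
  repeat rw [Finset.card_insert_of_notMem (by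
    simp only [Finset.mem_insert, Finset.mem_singleton, Prod.mk.injEq]; omega)]
  simp

/-- Subtracting the inequalities gives 2x + 1 > 2l - 4, so x is l, l - 1 or l - 2. On the last
column y² is squeezed to 4l + 4 = (2m)². -/
lemma one_sided_unit_iff {t : ℤ} (ht : 1 ≤ t) {m l : ℤ} (hm : m = 8 * t + 1) (hl : l = m ^ 2 - 1)
    (x y : ℤ) :
    (x ^ 2 + y ^ 2 ≤ l ^ 2 + 8 ∧ l ^ 2 + 2 * l + 4 < (x + 1) ^ 2 + y ^ 2) ↔
      (x = l ∧ (y = 2 ∨ y = -2)) ∨ (x = l - 2 ∧ (y = 2 * m ∨ y = -(2 * m))) := by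
  have hl80 : 80 ≤ l := by subst hl hm; nlinarith
  constructor
  · rintro ⟨h1, h2⟩
    have hx1 : l - 2 ≤ x := by nlinarith
    have hx2 : x ≤ l := by nlinarith [sq_nonneg y]
    obtain rfl | rfl | rfl : x = l ∨ x = l - 1 ∨ x = l - 2 := by omega
    · left
      refine ⟨rfl, ?_⟩
      have hy1 : y < 3 := by nlinarith
      have hy2 : -3 < y := by nlinarith
      have hy3 : 4 ≤ y ^ 2 := by nlinarith
      interval_cases y <;> simp_all
    · exfalso
      have hy1 : 2 * l + 5 ≤ y ^ 2 := by nlinarith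
      have hy2 : y ^ 2 ≤ 2 * l + 7 := by nlinarith
      -- Here y² is one of 2l + 5, 2l + 6, 2l + 7, none of which is a square mod 8.
      have hl8 : ∃ c, l = 8 * c := ⟨8 * t ^ 2 + 2 * t, by subst hl hm; ring⟩
      obtain ⟨c, hc⟩ := hl8
      have h8 : y ^ 2 % 8 = 0 ∨ y ^ 2 % 8 = 1 ∨ y ^ 2 % 8 = 4 := by
        have : y % 8 = 0 ∨ y % 8 = 1 ∨ y % 8 = 2 ∨ y % 8 = 3 ∨ y % 8 = 4 ∨ y % 8 = 5 ∨ y % 8 = 6 ∨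
          y % 8 = 7 := by omega
        rcases this with h | h | h | h | h | h | h | h <;> simp [pow_two, Int.mul_emod, h]
      omega
    · right
      refine ⟨rfl, ?_⟩
      have hy : y ^ 2 = (2 * m) ^ 2 := by nlinarith
      exact sq_eq_sq_iff_eq_or_eq_neg.mp hy
  · rintro (⟨rfl, rfl | rfl⟩ | ⟨rfl, rfl | rfl⟩) <;> constructor <;> nlinarith

lemma sepSet_unit {t : ℤ} (ht : 1 ≤ t) {m l : ℤ} (hm : m = 8 * t + 1) (hl : l = m ^ 2 - 1)
    {r Δ : ℝ} (hr : r = √((l ^ 2 + 8 : ℤ) : ℝ)) (hrΔ : r + Δ = √((l ^ 2 + 2 * l + 4 : ℤ) : ℝ)) :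
    sepSet r Δ (0, 0) (-1, 0) = unitSep m := by
  ext ⟨x, y⟩
  have hl80 : 80 ≤ l := by subst hl hm; nlinarith
  have h1 := one_sided_unit_iff ht hm hl x y
  -- The reflection x ↦ -1 - x exchanges the two centres, hence the two halves of the set.
  have h2 := one_sided_unit_iff ht hm hl (-1 - x) y
  rw [mem_sepSet_sqrt (by positivity) (by positivity) hr hrΔ]
  rw [show ((0 - x) ^ 2 + (0 - y) ^ 2 : ℤ) = x ^ 2 + y ^ 2 by ring,
    show ((-1 - x) ^ 2 + (0 - y) ^ 2 : ℤ) = (x + 1) ^ 2 + y ^ 2 by ring, h1]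
  rw [show ((-1 - x) ^ 2 + y ^ 2 : ℤ) = (x + 1) ^ 2 + y ^ 2 by ring,
    show ((-1 - x + 1) ^ 2 + y ^ 2 : ℤ) = x ^ 2 + y ^ 2 by ring] at h2
  rw [h2]
  have e1 : x = l ↔ x = m ^ 2 - 1 := by omega
  have e2 : x = l - 2 ↔ x = m ^ 2 - 3 := by omega
  have e3 : -1 - x = l ↔ x = -m ^ 2 := by omega
  have e4 : -1 - x = l - 2 ↔ x = 2 - m ^ 2 := by omega
  rw [e1, e2, e3, e4]
  simp only [unitSep, Finset.coe_insert, Finset.coe_singleton, Set.mem_insert_iff,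
    Set.mem_singleton_iff, Prod.mk.injEq, and_or_left, or_assoc]

lemma unitSep_intersectsDiagonals {t m : ℤ} (hm : m = 8 * t + 1) :
    IntersectsDiagonalsMod 8 (unitSep m : Set (ℤ × ℤ)) := by
  obtain ⟨c, hc⟩ : ∃ c, m ^ 2 = 8 * c + 1 := ⟨8 * t ^ 2 + 2 * t, by subst hm; ring⟩
  intro i hi
  have key : ∀ p ∈ unitSep m, (8 : ℤ) ∣ i - (p.2 - p.1) →
      ∃ p ∈ (unitSep m : Set (ℤ × ℤ)), p.2 - p.1 ≡ (i : ℤ) [ZMOD ((8 : ℕ) : ℤ)] :=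
    fun p hp h => ⟨p, hp, Int.modEq_iff_dvd.mpr h⟩
  interval_cases i
  · exact key (m ^ 2 - 3, -(2 * m)) (by simp [unitSep]) (by dsimp only; omega)
  · exact key (2 - m ^ 2, 2 * m) (by simp [unitSep]) (by dsimp only; omega)
  · exact key (m ^ 2 - 1, 2) (by simp [unitSep]) (by dsimp only; omega)
  · exact key (-m ^ 2, 2) (by simp [unitSep]) (by dsimp only; omega)
  · exact key (m ^ 2 - 3, 2 * m) (by simp [unitSep]) (by dsimp only; omega)
  · exact key (2 - m ^ 2, -(2 * m)) (by simp [unitSep]) (by dsimp only; omega)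
  · exact key (m ^ 2 - 1, -2) (by simp [unitSep]) (by dsimp only; omega)
  · exact key (-m ^ 2, -2) (by simp [unitSep]) (by dsimp only; omega)

/-! ### Pairs at distance greater than 1 -/

/-- The largest element of a residue class modulo `8` whose square does not exceed a given bound. -/
lemma exists_modEq_sq_le (M i : ℤ) (hM : 100 ≤ M) :
    ∃ p : ℤ, p ≡ i [ZMOD 8] ∧ 0 ≤ p ∧ p ^ 2 ≤ M ∧ M < (p + 8) ^ 2 := by
  have hM0 : 0 ≤ M := by omega
  set e : ℤ := (Nat.sqrt M.toNat : ℤ) with he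
  have h1 : e ^ 2 ≤ M := by
    have := Nat.sqrt_le' M.toNat
    zify at this; rwa [Int.toNat_of_nonneg hM0] at this
  have h2 : M < (e + 1) ^ 2 := by
    have := Nat.lt_succ_sqrt' M.toNat
    zify at this; rwa [Int.toNat_of_nonneg hM0] at this
  have h3 : 9 ≤ e := by nlinarith
  refine ⟨e - (e - i) % 8, ?_, by omega, ?_, ?_⟩
  · rw [Int.modEq_iff_dvd]; omega
  · have ha : 0 ≤ (e - i) % 8 := by omega
    have hb : (e - i) % 8 ≤ 7 := by omega
    nlinarith
  · have hb : (e - i) % 8 ≤ 7 := by omega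
    nlinarith

/-- Rotated coordinates p = x + y, q = y - x (up to signs) double the squared norm; a diagonal step
adds 4p + 4 to it. Since p ≈ √2·l, this exceeds the required 4l by enough to absorb the rounding of
q, about 16q. -/
lemma exists_modEq_near_circle {l : ℤ} (hl : 10000 ≤ l) (i j : ℤ) :
    ∃ p q : ℤ, p ≡ i [ZMOD 8] ∧ q ≡ j [ZMOD 8] ∧ 0 ≤ q ∧ q ≤ p ∧
      p ^ 2 + q ^ 2 ≤ 2 * l ^ 2 + 16 ∧ 2 * l ^ 2 + 4 * l + 10 ≤ (p + 2) ^ 2 + q ^ 2 := by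
  -- The margin 100 leaves at least 116 for q², as the second call needs.
  obtain ⟨p, hpi, hp0, hp1, hp2⟩ := exists_modEq_sq_le (2 * l ^ 2 - 100) i (by nlinarith)
  obtain ⟨q, hqj, hq0, hq1, hq2⟩ :=
    exists_modEq_sq_le (2 * l ^ 2 + 16 - p ^ 2) j (by linarith)
  have hpl : 14 * l ≤ 10 * p + 90 := by nlinarith
  have hpu : p ≤ 2 * l := by nlinarith
  have hq3 : q ^ 2 ≤ 32 * l + 180 := by nlinarith
  have hq4 : 12 * q ≤ l := by
    by_contra! h
    have h' : l * l < 144 * q ^ 2 := by nlinarith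
    nlinarith
  refine ⟨p, q, hpi, hqj, hq0, by omega, by linarith, ?_⟩
  nlinarith

/-- Every diagonal modulo `8` contains a point `p` with `|p|² ≤ A` and `|p + w|² > B`. -/
def OneSided (A B : ℤ) (w : ℤ × ℤ) : Prop :=
  ∀ i : ℤ, ∃ x y : ℤ, y - x ≡ i [ZMOD 8] ∧ x ^ 2 + y ^ 2 ≤ A ∧ B < (x + w.1) ^ 2 + (y + w.2) ^ 2

lemma OneSided.neg {A B a b : ℤ} (h : OneSided A B (a, b)) : OneSided A B (-a, -b) := by
  intro i
  obtain ⟨x, y, h1, h2, h3⟩ := h (-i)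
  refine ⟨-x, -y, ?_, by linarith, by dsimp only at h3 ⊢; linarith⟩
  convert h1.neg using 1 <;> ring

lemma OneSided.swap {A B a b : ℤ} (h : OneSided A B (a, b)) : OneSided A B (b, a) := by
  intro i
  obtain ⟨x, y, h1, h2, h3⟩ := h (-i)
  refine ⟨y, x, ?_, by linarith, by dsimp only at h3 ⊢; linarith⟩
  convert h1.neg using 1 <;> ring

lemma oneSided_axis {l a : ℤ} (hl : 80 ≤ l) (ha : 2 ≤ a) :
    OneSided (l ^ 2 + 8) (l ^ 2 + 2 * l + 4) (a, 0) := by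
  intro i
  -- Eight consecutive y cover all residues; y ≥ 2 puts (l + 1)² + y² above the outer bound.
  obtain ⟨y, hy, hy1, hy2⟩ : ∃ y : ℤ, y - (l - 1) ≡ i [ZMOD 8] ∧ 2 ≤ y ∧ y ≤ 9 :=
    ⟨2 + (i + (l - 1) - 2) % 8, by rw [Int.modEq_iff_dvd]; omega, by omega, by omega⟩
  refine ⟨l - 1, y, hy, by nlinarith, ?_⟩
  dsimp only
  have : (l + 1) ^ 2 ≤ (l - 1 + a) ^ 2 := pow_le_pow_left₀ (by linarith) (by linarith) 2
  nlinarith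

lemma oneSided_pos_pos {l a b : ℤ} (hl : 10000 ≤ l) (ha : 1 ≤ a) (hb : 1 ≤ b) :
    OneSided (l ^ 2 + 8) (l ^ 2 + 2 * l + 4) (a, b) := by
  intro i
  -- Equal residues give p and q the same parity, so x = (p - q)/2 is integral.
  obtain ⟨p, q, hp, hq, hq0, hqp, h1, h2⟩ := exists_modEq_near_circle hl i i
  obtain ⟨x, rfl⟩ : ∃ x, p = q + 2 * x := ⟨(p - q) / 2, by
    have := Int.modEq_iff_dvd.mp (hp.trans hq.symm); omega⟩
  refine ⟨x, x + q, by simpa using hq, by linarith, ?_⟩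
  dsimp only
  have e1 : (x + 1) ^ 2 ≤ (x + a) ^ 2 :=
    pow_le_pow_left₀ (by linarith) (by linarith) 2
  have e2 : (x + q + 1) ^ 2 ≤ (x + q + b) ^ 2 :=
    pow_le_pow_left₀ (by linarith) (by linarith) 2
  linarith

lemma oneSided_pos_neg {l a b : ℤ} (hl : 10000 ≤ l) (ha : 1 ≤ a) (hb : 1 ≤ b) :
    OneSided (l ^ 2 + 8) (l ^ 2 + 2 * l + 4) (a, -b) := by
  intro i
  obtain ⟨p, q, hp, hq, hq0, hqp, h1, h2⟩ := exists_modEq_near_circle hl (-i) (-i)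
  obtain ⟨y, rfl⟩ : ∃ y, p = q + 2 * y := ⟨(p - q) / 2, by
    have := Int.modEq_iff_dvd.mp (hp.trans hq.symm); omega⟩
  refine ⟨y + q, -y, ?_, by linarith, ?_⟩
  · convert hp.neg using 1 <;> ring
  dsimp only
  have e1 : (y + q + 1) ^ 2 ≤ (y + q + a) ^ 2 :=
    pow_le_pow_left₀ (by linarith) (by linarith) 2
  have e2 : (y + 1) ^ 2 ≤ (y + b) ^ 2 :=
    pow_le_pow_left₀ (by linarith) (by linarith) 2
  linarith

lemma oneSided_of_two_le {l a b : ℤ} (hl : 10000 ≤ l) (h : 2 ≤ a ^ 2 + b ^ 2) :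
    OneSided (l ^ 2 + 8) (l ^ 2 + 2 * l + 4) (a, b) := by
  have axis : ∀ c : ℤ, 2 ≤ c ^ 2 → OneSided (l ^ 2 + 8) (l ^ 2 + 2 * l + 4) (c, 0) := by
    intro c hc
    rcases le_total 0 c with h0 | h0
    · exact oneSided_axis (by linarith) (by nlinarith)
    · simpa using (oneSided_axis (l := l) (a := -c) (by linarith) (by nlinarith)).neg
  rcases lt_trichotomy a 0 with ha | rfl | ha <;> rcases lt_trichotomy b 0 with hb | rfl | hb
  · simpa using (oneSided_pos_pos hl (a := -a) (b := -b) (by linarith) (by linarith)).neg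
  · exact axis a (by simpa using h)
  · simpa using (oneSided_pos_neg hl (a := -a) (b := b) (by linarith) (by linarith)).neg
  · exact (axis b (by simpa using h)).swap
  · simp at h
  · exact (axis b (by simpa using h)).swap
  · simpa using oneSided_pos_neg hl (a := a) (b := -b) (by linarith) (by linarith)
  · exact axis a (by simpa using h)
  · exact oneSided_pos_pos hl ha hb

/-! ### The diagonal code is identifying -/

lemma sepSet_comm (r Δ : ℝ) (u v : ℤ × ℤ) : sepSet r Δ u v = sepSet r Δ v u :=
  Set.union_comm _ _

/-- The diagonals `y - x ≡ 0` modulo `8`. -/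
def diagonalCode : Set (ℤ × ℤ) := {p | p.2 - p.1 ≡ 0 [ZMOD 8]}

lemma ball_add {r : ℝ} (u v p : ℤ × ℤ) : p + v ∈ ball r (u + v) ↔ p ∈ ball r u := by
  simp [ball, dist_toPlane]

lemma sepSet_add {r Δ : ℝ} (u v w p : ℤ × ℤ) :
    p + w ∈ sepSet r Δ (u + w) (v + w) ↔ p ∈ sepSet r Δ u v := by
  simp [sepSet, ball_add]

lemma swap_mem_ball {r : ℝ} (u p : ℤ × ℤ) : p.swap ∈ ball r u.swap ↔ p ∈ ball r u := by
  simp [ball, dist_toPlane, add_comm]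

lemma swap_mem_sepSet {r Δ : ℝ} (u v p : ℤ × ℤ) :
    p.swap ∈ sepSet r Δ u.swap v.swap ↔ p ∈ sepSet r Δ u v := by
  simp [sepSet, swap_mem_ball]

lemma swap_mem_diagonalCode (p : ℤ × ℤ) : p.swap ∈ diagonalCode ↔ p ∈ diagonalCode := by
  simp only [diagonalCode, Set.mem_ofPred_eq, Prod.fst_swap, Prod.snd_swap, Int.modEq_iff_dvd]
  omega

lemma sepSet_inter_diagonalCode_of_intersects {r Δ : ℝ} {v : ℤ × ℤ}
    (h : IntersectsDiagonalsMod 8 (sepSet r Δ (0, 0) v)) (u : ℤ × ℤ) :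
    (sepSet r Δ u (v + u) ∩ diagonalCode).Nonempty := by
  obtain ⟨p, hp, hpi⟩ := h ((u.1 - u.2) % 8).toNat (by omega)
  refine ⟨p + u, ?_, ?_⟩
  · simpa only [Prod.mk_zero_zero, zero_add] using (sepSet_add (0, 0) v u p).mpr hp
  · simp only [diagonalCode, Set.mem_ofPred_eq, Prod.fst_add, Prod.snd_add]
    rw [Int.modEq_iff_dvd] at *
    push_cast at hpi
    omega

lemma sepSet_inter_diagonalCode {l : ℤ} (hl : 10000 ≤ l)
    {r Δ : ℝ} (hr : r = √((l ^ 2 + 8 : ℤ) : ℝ)) (hrΔ : r + Δ = √((l ^ 2 + 2 * l + 4 : ℤ) : ℝ))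
    (hunit : IntersectsDiagonalsMod 8 (sepSet r Δ (0, 0) (-1, 0))) {u v : ℤ × ℤ} (huv : u ≠ v) :
    (sepSet r Δ u v ∩ diagonalCode).Nonempty := by
  have horiz : ∀ u : ℤ × ℤ, (sepSet r Δ u (u.1 - 1, u.2) ∩ diagonalCode).Nonempty := by
    intro u
    convert sepSet_inter_diagonalCode_of_intersects hunit u using 3
    ext <;> simp; ring
  have vert : ∀ u : ℤ × ℤ, (sepSet r Δ u (u.1, u.2 - 1) ∩ diagonalCode).Nonempty := by
    intro u
    obtain ⟨p, hp, hpC⟩ := horiz u.swap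
    exact ⟨p.swap, (swap_mem_sepSet u.swap (u.2 - 1, u.1) p).mpr hp,
      (swap_mem_diagonalCode p).mpr hpC⟩
  obtain ⟨a, b⟩ := u
  obtain ⟨c, d⟩ := v
  obtain ⟨s, rfl⟩ : ∃ s, c = a - s := ⟨a - c, by ring⟩
  obtain ⟨t, rfl⟩ : ∃ t, d = b - t := ⟨b - d, by ring⟩
  by_cases h2 : 2 ≤ s ^ 2 + t ^ 2
  · obtain ⟨x, y, h1, h3, h4⟩ := oneSided_of_two_le hl h2 (a - b)
    refine ⟨(x + a, y + b), ?_, ?_⟩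
    · rw [mem_sepSet_sqrt (by positivity) (by positivity) hr hrΔ]
      left
      constructor <;> dsimp only at * <;> linarith
    · simp only [diagonalCode, Set.mem_ofPred_eq]
      rw [Int.modEq_iff_dvd] at *
      omega
  · have h1 : -1 ≤ s := by nlinarith [sq_nonneg t]
    have h1' : s ≤ 1 := by nlinarith [sq_nonneg t]
    have h3 : -1 ≤ t := by nlinarith [sq_nonneg s]
    have h3' : t ≤ 1 := by nlinarith [sq_nonneg s]
    have hne : ¬ (s = 0 ∧ t = 0) := by
      rintro ⟨rfl, rfl⟩
      simp at huv
    interval_cases s <;> interval_cases t <;> simp at h2 hne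
    · rw [sepSet_comm]; simpa using horiz (a + 1, b)
    · rw [sepSet_comm]; simpa using vert (a, b + 1)
    · simpa using vert (a, b)
    · simpa using horiz (a, b)

lemma isIdentifyingCode_diagonalCode {l : ℤ} (hl : 10000 ≤ l)
    {r Δ : ℝ} (hr : r = √((l ^ 2 + 8 : ℤ) : ℝ)) (hrΔ : r + Δ = √((l ^ 2 + 2 * l + 4 : ℤ) : ℝ))
    (hunit : IntersectsDiagonalsMod 8 (sepSet r Δ (0, 0) (-1, 0))) :
    IsIdentifyingCode r Δ diagonalCode := by
  refine ⟨fun u => ⟨(u.1, u.2 - (u.2 - u.1) % 8), ?_, ?_⟩,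
    fun u v huv => sepSet_inter_diagonalCode hl hr hrΔ hunit huv⟩
  · rw [hr, mem_ball_sqrt (by positivity)]
    have h1 : 0 ≤ (u.2 - u.1) % 8 := by omega
    have h2 : (u.2 - u.1) % 8 ≤ 7 := by omega
    dsimp only
    nlinarith
  · simp only [diagonalCode, Set.mem_ofPred_eq, Int.modEq_iff_dvd]
    omega

/-! ### Density bounds -/

lemma square_eq (n : ℕ) :
    square n = ((Finset.Icc (-n : ℤ) n ×ˢ Finset.Icc (-n : ℤ) n : Finset (ℤ × ℤ)) : Set (ℤ × ℤ)) := by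
  ext p
  simp only [square, Set.mem_ofPred_eq, abs_le, Finset.mem_coe, Finset.mem_product, Finset.mem_Icc]

lemma finite_square (n : ℕ) : (square n).Finite := by
  rw [square_eq]; exact Finset.finite_toSet _

lemma ncard_square (n : ℕ) : (square n).ncard = (2 * n + 1) ^ 2 := by
  rw [square_eq, Set.ncard_coe_finset, Finset.card_product, Int.card_Icc, pow_two]
  congr <;> omega

lemma ncard_inter_square_div_le_one (C : Set (ℤ × ℤ)) (n : ℕ) :
    ((C ∩ square n).ncard : ℝ) / ((square n).ncard : ℝ) ≤ 1 :=
  div_le_one_of_le₀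
    (by exact_mod_cast Set.ncard_le_ncard Set.inter_subset_right (finite_square n)) (by positivity)

/-- If every translate of the finite set `S` meets `C`, then `C` has at least `1 / |S|` of the points
of a large square. -/
lemma ncard_square_le {C : Set (ℤ × ℤ)} {S : Finset (ℤ × ℤ)} {R : ℕ}
    (hR : ∀ s ∈ S, s ∈ square R) (h : ∀ u, ∃ s ∈ S, s + u ∈ C) (n : ℕ) :
    (square n).ncard ≤ S.card * (C ∩ square (n + R)).ncard := by
  classical
  have hfin : (C ∩ square (n + R)).Finite := (finite_square _).inter_of_right _
  have hsub : square n ⊆ ((S.biUnion fun s => hfin.toFinset.image (fun p => p - s) :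
      Finset (ℤ × ℤ)) : Set (ℤ × ℤ)) := by
    intro u hu
    obtain ⟨s, hs, hC⟩ := h u
    simp only [Finset.coe_biUnion, Set.mem_iUnion, Finset.mem_coe, Finset.mem_image,
      Set.Finite.mem_toFinset]
    refine ⟨s, hs, s + u, ⟨hC, ?_⟩, by simp⟩
    have h1 := hR s hs
    simp only [square, Set.mem_ofPred_eq, abs_le, Prod.fst_add, Prod.snd_add, Nat.cast_add] at *
    omega
  calc (square n).ncard ≤ (S.biUnion fun s => hfin.toFinset.image (fun p => p - s)).card := by
        rw [← Set.ncard_coe_finset]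
        exact Set.ncard_le_ncard hsub (Finset.finite_toSet _)
    _ ≤ S.card * (C ∩ square (n + R)).ncard := by
        refine Finset.card_biUnion_le_card_mul _ _ _ fun s _ => ?_
        rw [Set.ncard_eq_toFinset_card _ hfin]
        exact Finset.card_image_le

lemma tendsto_affine_ratio (c : ℝ) :
    Tendsto (fun n : ℕ => (2 * (n : ℝ) + c) / (2 * (n : ℝ) + 1)) atTop (𝓝 1) := by
  have h1 : Tendsto (fun n : ℕ => 2 * (n : ℝ) + 1) atTop atTop :=
    tendsto_atTop_add_const_right _ _
      (tendsto_natCast_atTop_atTop.const_mul_atTop (by norm_num))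
  have h2 : Tendsto (fun n : ℕ => 1 + (c - 1) / (2 * (n : ℝ) + 1)) atTop (𝓝 (1 + 0)) :=
    tendsto_const_nhds.add (h1.const_div_atTop _)
  rw [add_zero] at h2
  refine h2.congr fun n => ?_
  have : (2 * (n : ℝ) + 1) ≠ 0 := by positivity
  field_simp
  ring

lemma inv_card_le_density {C : Set (ℤ × ℤ)} {S : Finset (ℤ × ℤ)} (hS : 0 < S.card)
    (h : ∀ u, ∃ s ∈ S, s + u ∈ C) : 1 / (S.card : ℝ) ≤ density C := by
  obtain ⟨R, hR⟩ : ∃ R : ℕ, ∀ s ∈ S, s ∈ square R := by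
    refine ⟨∑ s ∈ S, (s.1.natAbs + s.2.natAbs), fun s hs => ?_⟩
    have := Finset.single_le_sum (f := fun s : ℤ × ℤ => s.1.natAbs + s.2.natAbs)
      (fun _ _ => Nat.zero_le _) hs
    simp only [square, Set.mem_ofPred_eq, abs_le]
    omega
  have hS' : (0 : ℝ) < S.card := by exact_mod_cast hS
  -- Counting in Q_{n-R} loses a boundary layer of width R, negligible in the limit.
  have ht : Tendsto (fun n : ℕ => 1 / (S.card : ℝ) *
      ((2 * (n : ℝ) + (1 - 2 * R)) / (2 * (n : ℝ) + 1)) ^ 2) atTop (𝓝 (1 / (S.card : ℝ))) := by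
    simpa using ((tendsto_affine_ratio (1 - 2 * R)).pow 2).const_mul (1 / (S.card : ℝ))
  rw [density, ← ht.limsup_eq]
  refine limsup_le_limsup ?_ ht.isCoboundedUnder_le
    (isBoundedUnder_of ⟨1, ncard_inter_square_div_le_one C⟩)
  filter_upwards [eventually_ge_atTop R] with n hn
  obtain ⟨k, rfl⟩ := Nat.exists_eq_add_of_le' hn
  have key : ((2 * k + 1 : ℝ)) ^ 2 ≤ S.card * (C ∩ square (k + R)).ncard := by
    have := ncard_square_le hR h k
    rw [ncard_square] at this
    exact_mod_cast this
  rw [ncard_square, div_pow, div_mul_div_comm, one_mul]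
  push_cast
  rw [div_le_div_iff₀ (by positivity) (by positivity)]
  have e : (2 * ((k : ℝ) + R) + (1 - 2 * R)) = 2 * k + 1 := by ring
  rw [e]
  calc _ ≤ (S.card * (C ∩ square (k + R)).ncard : ℝ) * (2 * ((k : ℝ) + R) + 1) ^ 2 := by gcongr
    _ = _ := by ring

lemma card_modEq_Icc_le (n : ℕ) (y : ℤ) :
    8 * ((Finset.Icc (-n : ℤ) n).filter (fun x => x ≡ y [ZMOD 8])).card ≤ 2 * n + 9 := by
  have hsub : (Finset.Icc (-n : ℤ) n).filter (fun x => x ≡ y [ZMOD 8]) ⊆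
      (Finset.Icc ((-n - y + 7) / 8) ((n - y) / 8)).image (fun z => y + 8 * z) := by
    intro x hx
    simp only [Finset.mem_filter, Finset.mem_Icc, Finset.mem_image, Int.modEq_iff_dvd] at hx ⊢
    exact ⟨(x - y) / 8, by omega, by omega⟩
  have := (Finset.card_le_card hsub).trans Finset.card_image_le
  rw [Int.card_Icc] at this
  omega

lemma ncard_diagonalCode_square_le (n : ℕ) :
    8 * (diagonalCode ∩ square n).ncard ≤ (2 * n + 1) * (2 * n + 9) := by
  classical
  have hsub : diagonalCode ∩ square n ⊆ (((Finset.Icc (-n : ℤ) n).biUnion fun y =>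
      ((Finset.Icc (-n : ℤ) n).filter (fun x => x ≡ y [ZMOD 8])).image (fun x => (x, y)) :
      Finset (ℤ × ℤ)) : Set (ℤ × ℤ)) := by
    rintro ⟨x, y⟩ ⟨h1, h2⟩
    simp only [diagonalCode, square, Set.mem_ofPred_eq, abs_le, Int.modEq_iff_dvd] at h1 h2
    simp only [Finset.coe_biUnion, Set.mem_iUnion, Finset.mem_coe, Finset.mem_image,
      Finset.mem_filter, Finset.mem_Icc, Int.modEq_iff_dvd]
    exact ⟨y, h2.2, x, ⟨h2.1, by omega⟩, rfl⟩
  have h1 := (Set.ncard_le_ncard hsub (Finset.finite_toSet _)).trans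
    ((Set.ncard_coe_finset _).trans_le Finset.card_biUnion_le)
  have h2 : 8 * (∑ y ∈ Finset.Icc (-n : ℤ) n, (((Finset.Icc (-n : ℤ) n).filter
      (fun x => x ≡ y [ZMOD 8])).image (fun x => (x, y))).card) ≤ (2 * n + 1) * (2 * n + 9) := by
    rw [Finset.mul_sum]
    refine (Finset.sum_le_card_nsmul _ _ (2 * n + 9) fun y _ => ?_).trans_eq ?_
    · exact (Nat.mul_le_mul_left _ Finset.card_image_le).trans (card_modEq_Icc_le n y)
    · rw [Int.card_Icc, smul_eq_mul]
      congr 1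
      omega
  omega

lemma density_diagonalCode_le : density diagonalCode ≤ 1 / 8 := by
  have ht : Tendsto (fun n : ℕ => 1 / (8 : ℝ) *
      ((2 * (n : ℝ) + 9) / (2 * (n : ℝ) + 1))) atTop (𝓝 (1 / 8)) := by
    simpa using (tendsto_affine_ratio 9).const_mul (1 / (8 : ℝ))
  rw [density, ← ht.limsup_eq]
  refine limsup_le_limsup (Eventually.of_forall fun n => ?_)
    (isCoboundedUnder_le_of_le atTop (x := 0) fun n => by positivity) ht.isBoundedUnder_le
  have h : (8 * (diagonalCode ∩ square n).ncard : ℝ) ≤ (2 * n + 1) * (2 * n + 9) := by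
    exact_mod_cast ncard_diagonalCode_square_le n
  dsimp only
  rw [ncard_square, div_mul_div_comm, one_mul]
  push_cast
  rw [div_le_div_iff₀ (by positivity) (by positivity)]
  calc _ = (8 * (diagonalCode ∩ square n).ncard : ℝ) * (2 * n + 1) := by ring
    _ ≤ ((2 * n + 1) * (2 * n + 9)) * (2 * n + 1) := by gcongr
    _ = _ := by ring

lemma IsIdentifyingCode.one_eighth_le_density {r Δ : ℝ} {C : Set (ℤ × ℤ)} {S : Finset (ℤ × ℤ)}
    {v : ℤ × ℤ} (hC : IsIdentifyingCode r Δ C) (hv : v ≠ 0) (hS : sepSet r Δ 0 v = S)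
    (hcard : S.card = 8) : 1 / 8 ≤ density C := by
  have h : ∀ u, ∃ s ∈ S, s + u ∈ C := by
    intro u
    obtain ⟨p, hp, hpC⟩ := hC.2 (0 + u) (v + u) (fun h => hv (add_right_cancel h).symm)
    refine ⟨p - u, ?_, by simpa using hpC⟩
    rw [← Finset.mem_coe, ← hS, ← sepSet_add 0 v u, sub_add_cancel]
    exact hp
  have := inv_card_le_density (by omega) h
  simpa [hcard] using this

/-! ### Assembly -/

lemma exists_eq_of_modEq {k : ℤ} {L r Δ : ℝ} (hk : 18 ≤ k) (hk' : k ≡ 2 [ZMOD 16])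
    (hL : L = ((k : ℝ) / 2) ^ 2 - 1) (hr : r = √(L ^ 2 + 8)) (hrΔ : r + Δ = √(L ^ 2 + 2 * L + 4)) :
    ∃ t m l : ℤ, 1 ≤ t ∧ m = 8 * t + 1 ∧ l = m ^ 2 - 1 ∧ r = √((l ^ 2 + 8 : ℤ) : ℝ) ∧
      r + Δ = √((l ^ 2 + 2 * l + 4 : ℤ) : ℝ) := by
  obtain ⟨t, ht⟩ := hk'.symm.dvd
  obtain rfl : k = 16 * t + 2 := by omega
  have e : L = (((8 * t + 1) ^ 2 - 1 : ℤ) : ℝ) := by rw [hL]; push_cast; ring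
  refine ⟨t, _, _, by omega, rfl, rfl, ?_, ?_⟩
  · rw [hr, e]; push_cast; rfl
  · rw [hrΔ, e]; push_cast; rfl

end TolerantCode

theorem mainTheorem5 :
    (∀ (k : ℤ) (L r Δ : ℝ), 18 ≤ k → k ≡ 2 [ZMOD 16] → L = ((k : ℝ) / 2) ^ 2 - 1 →
      r = √(L ^ 2 + 8) → r + Δ = √(L ^ 2 + 2 * L + 4) →
        (TolerantCode.sepSet r Δ (0, 0) (-1, 0)).encard = 8 ∧
        TolerantCode.IntersectsDiagonalsMod 8 (TolerantCode.sepSet r Δ (0, 0) (-1, 0))) ∧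
    (∃ r₀ : ℝ, ∀ (k : ℤ) (L r Δ : ℝ), 18 ≤ k → k ≡ 2 [ZMOD 16] → L = ((k : ℝ) / 2) ^ 2 - 1 →
      r = √(L ^ 2 + 8) → r + Δ = √(L ^ 2 + 2 * L + 4) → r₀ ≤ r →
        ∃ C : Set (ℤ × ℤ), TolerantCode.IsOptimalCode r Δ C ∧ TolerantCode.density C = 1 / 8) := by
  refine ⟨fun k L r Δ hk hk' hL hr hrΔ => ?_, 10001, fun k L r Δ hk hk' hL hr hrΔ hr₀ => ?_⟩ <;>
  obtain ⟨t, m, l, ht, hm, hl, hr, hrΔ⟩ := TolerantCode.exists_eq_of_modEq hk hk' hL hr hrΔ <;>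
  have hS := TolerantCode.sepSet_unit ht hm hl hr hrΔ <;>
  have hcard := TolerantCode.card_unitSep (m := m) (by omega) <;>
  have hdiag := TolerantCode.unitSep_intersectsDiagonals hm
  · rw [hS, Set.encard_coe_eq_coe_finsetCard, hcard]
    exact ⟨rfl, hdiag⟩
  · have hl0 : 0 ≤ l := by subst hl hm; nlinarith
    -- r₀ = 10001 exceeds 10000 by enough to absorb the 8 in r² = l² + 8.
    have hl' : 10000 ≤ l := by
      rw [hr, Real.le_sqrt' (by norm_num)] at hr₀
      have h : (10001 : ℤ) ^ 2 ≤ l ^ 2 + 8 := by exact_mod_cast hr₀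
      nlinarith
    have hlow : ∀ C, TolerantCode.IsIdentifyingCode r Δ C → 1 / 8 ≤ TolerantCode.density C :=
      fun C hC => hC.one_eighth_le_density (v := (-1, 0)) (by simp) hS hcard
    have hcode := TolerantCode.isIdentifyingCode_diagonalCode hl' hr hrΔ (hS ▸ hdiag)
    exact ⟨_, ⟨hcode, fun C' hC' => TolerantCode.density_diagonalCode_le.trans (hlow C' hC')⟩,
      TolerantCode.density_diagonalCode_le.antisymm (hlow _ hcode)⟩
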